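/- Let $P=\operatorname{conv}\{\pm e_1,\pm e_2,\pm e_3,\pm e_4\}\subset\mathbb{R}^4$ be the $4$-orthoplex. Its facets are its $3$-dimensional faces and its ridges are its $2$-dimensional faces. Let $\Gamma$ be the dual graph of $P$: its nodes are the facets of $P$, and two distinct facets are adjacent when their intersection is a ridge. A ridge unfolding of $P$ consists of a spanning tree $T$ of $\Gamma$ (the ridges corresponding to edges of $T$ stay uncut, all others are cut) together with a development into $\mathbb{R}^3$: every facet $F$ is mapped isometrically into $\mathbb{R}^3$ by a map $\varphi_F$, and whenever $F,G$ are adjacent in $T$, the maps $\varphi_F$ and $\varphi_G$ agree on the ridge $F\cap G$, and the images of $F$ and $G$ lie on opposite sides of the plane spanned by the image of that ridge. A ridge unfolding is a net if it has no overlap, i.e. if the interiors of $\varphi_F(F)$ and $\varphi_G(G)$ are disjoint for all facets $F\neq G$. **Theorem.** The $4$-orthoplex is all-net: every spanning tree $T$ of $\Gamma$ is the tree of a ridge unfolding of $P$, and every ridge unfolding of $P$ is a net. -/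

import Mathlib

namespace RidgeUnfold

/-- The `n`-orthoplex (cross-polytope): the convex hull of `±e₁, …, ±eₙ` in Euclidean `n`-space. -/
def orthoplex (n : ℕ) : Set (EuclideanSpace ℝ (Fin n)) :=
  convexHull ℝ
    (Set.range (fun i : Fin n => EuclideanSpace.single i (1 : ℝ)) ∪
      Set.range (fun i : Fin n => -EuclideanSpace.single i (1 : ℝ)))

/-- `F` is a nonempty (exposed) face of dimension `k` of the convex polytope `P`. -/
def IsFaceOfDim {m : ℕ} (P : Set (EuclideanSpace ℝ (Fin m))) (k : ℕ)
    (F : Set (EuclideanSpace ℝ (Fin m))) : Prop :=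
  IsExposed ℝ P F ∧ F.Nonempty ∧ Module.finrank ℝ (vectorSpan ℝ F) = k

/-- The facets, i.e. the codimension-one faces, of a full-dimensional convex polytope `P` in
Euclidean `(n + 1)`-space. -/
def Facet {n : ℕ} (P : Set (EuclideanSpace ℝ (Fin (n + 1)))) : Type :=
  {F : Set (EuclideanSpace ℝ (Fin (n + 1))) // IsFaceOfDim P n F}

/-- The underlying set of points of a facet. -/
def Facet.pts {n : ℕ} {P : Set (EuclideanSpace ℝ (Fin (n + 1)))} (F : Facet P) :
    Set (EuclideanSpace ℝ (Fin (n + 1))) :=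
  F.1

/-- `R` is a ridge, i.e. a codimension-two face, of a full-dimensional convex polytope `P` in
Euclidean `(n + 1)`-space. -/
def IsRidge {n : ℕ} (P R : Set (EuclideanSpace ℝ (Fin (n + 1)))) : Prop :=
  ∃ k : ℕ, k + 1 = n ∧ IsFaceOfDim P k R

/-- The 1-skeleton of the dual of `P`: its nodes are the facets of `P`, and two distinct facets are
adjacent when they share a ridge. -/
def dualGraph {n : ℕ} (P : Set (EuclideanSpace ℝ (Fin (n + 1)))) : SimpleGraph (Facet P) where
  Adj F G := F ≠ G ∧ IsRidge P (F.pts ∩ G.pts)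
  symm := ⟨fun F G h => ⟨h.1.symm, by rw [Set.inter_comm]; exact h.2⟩⟩
  loopless := ⟨fun _ h => h.1 rfl⟩

/-- `T` is a spanning tree of the 1-skeleton of the dual of `P`. (A `SimpleGraph` on the type of all
facets automatically contains every node.) -/
def IsSpanningTree {n : ℕ} (P : Set (EuclideanSpace ℝ (Fin (n + 1))))
    (T : SimpleGraph (Facet P)) : Prop :=
  T ≤ dualGraph P ∧ T.IsTree

/-- A ridge unfolding of a full-dimensional convex polytope `P` in Euclidean `(n + 1)`-space:
all ridges are cut except those corresponding to the edges of a spanning tree of the 1-skeleton of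
the dual, and the resulting arrangement of facets is developed isometrically into `n`-space. -/
structure RidgeUnfolding {n : ℕ} (P : Set (EuclideanSpace ℝ (Fin (n + 1)))) where
  /-- The spanning tree of uncut ridges. -/
  tree : SimpleGraph (Facet P)
  isSpanningTree : IsSpanningTree P tree
  /-- Where each facet is placed in `n`-space; only the values of `place F` on the facet `F`
  itself matter. -/
  place : Facet P → (EuclideanSpace ℝ (Fin (n + 1)) →ᵃ[ℝ] EuclideanSpace ℝ (Fin n))
  /-- Every facet is placed isometrically. -/
  isometric : ∀ F : Facet P, ∀ x ∈ F.pts, ∀ y ∈ F.pts, dist (place F x) (place F y) = dist x y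
  /-- Two facets stay attached to each other along an uncut ridge. -/
  attached : ∀ F G : Facet P, tree.Adj F G → ∀ x ∈ F.pts ∩ G.pts, place F x = place G x
  /-- Across an uncut ridge the two facets are flattened out, not folded onto each other: they lie on
  opposite sides of the hyperplane of `n`-space spanned by the ridge. -/
  flat : ∀ F G : Facet P, tree.Adj F G → ∀ x ∈ F.pts \ G.pts, ∀ y ∈ G.pts \ F.pts,
    (affineSpan ℝ (place F '' (F.pts ∩ G.pts))).SOppSide (place F x) (place G y)

/-- The region of `n`-space that the facet `F` occupies in the unfolding `U`. -/
def RidgeUnfolding.image {n : ℕ} {P : Set (EuclideanSpace ℝ (Fin (n + 1)))}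
    (U : RidgeUnfolding P) (F : Facet P) : Set (EuclideanSpace ℝ (Fin n)) :=
  U.place F '' F.pts

/-- An unfolding is a net when it is without overlap: distinct unfolded facets have no
interior point in common. -/
def RidgeUnfolding.IsNet {n : ℕ} {P : Set (EuclideanSpace ℝ (Fin (n + 1)))}
    (U : RidgeUnfolding P) : Prop :=
  ∀ F G : Facet P, F ≠ G → Disjoint (interior (U.image F)) (interior (U.image G))

/-- `P` is all-net when every ridge unfolding of `P` is a net. -/
def IsAllNet {n : ℕ} (P : Set (EuclideanSpace ℝ (Fin (n + 1)))) : Prop :=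
  ∀ U : RidgeUnfolding P, U.IsNet

end RidgeUnfold

/-! Facets of the orthoplex correspond to sign vectors, and facets sharing a ridge differ in one
sign, so the dual graph is treated as the 4-cube. A regular tetrahedron can be continued across a
face only by reflection (`IsRegular.eq_refl`). Hence the images of two facets differ by successive
reflections along the word of sign flips read off the tree path, and this path is a self-avoiding
walk in the 4-cube (`points_eq_develop`, `trace_word`).

To keep two tetrahedra apart it is enough to have an affine functional that is nonnegative and
nonzero on the vertices of the first and nonpositive on those of the second. Affine maps commute
with `develop`, so this is a statement about the four values of the functional: `Separated w`
depends on the word alone. Permuting coordinates and translating signs leaves finitely many walks,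
and for each one `dfs` finds a certificate among the planes between consecutive tetrahedra.
`separated_of_dfs` turns the computation into a proof.

Conversely, developing a regular tetrahedron along the tree paths from a root gives an unfolding for
every spanning tree. -/

namespace RidgeUnfold

/-! ### The computer search over self-avoiding walks -/

/-- Integer vectors with four entries. -/
structure Vec where
  a : ℤ
  b : ℤ
  c : ℤ
  d : ℤ

/-- Three times the action of `refl` on coordinates. -/
def Vec.act (v : Vec) : Fin 4 → Vec
  | 0 => ⟨2 * (v.b + v.c + v.d) - 3 * v.a, 3 * v.b, 3 * v.c, 3 * v.d⟩
  | 1 => ⟨3 * v.a, 2 * (v.a + v.c + v.d) - 3 * v.b, 3 * v.c, 3 * v.d⟩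
  | 2 => ⟨3 * v.a, 3 * v.b, 2 * (v.a + v.b + v.d) - 3 * v.c, 3 * v.d⟩
  | 3 => ⟨3 * v.a, 3 * v.b, 3 * v.c, 2 * (v.a + v.b + v.c) - 3 * v.d⟩

/-- Matching on constructors keeps the sign test cheap for kernel evaluation. -/
def nonneg : ℤ → Bool
  | .ofNat _ => true
  | .negSucc _ => false

def Vec.nonneg (v : Vec) : Bool :=
  RidgeUnfold.nonneg v.a && RidgeUnfold.nonneg v.b && RidgeUnfold.nonneg v.c &&
    RidgeUnfold.nonneg v.d

def Vec.unit : Fin 4 → Vec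
  | 0 => ⟨1, 0, 0, 0⟩
  | 1 => ⟨0, 1, 0, 0⟩
  | 2 => ⟨0, 0, 1, 0⟩
  | 3 => ⟨0, 0, 0, 1⟩

/-- Depth-first search through the self-avoiding walks on the four-cube, up to permutations of the
coordinates: `rev` is the reversed word of flips so far, `vis` the bit set of visited vertices, `v`
the present vertex, `mx` the number of coordinates flipped so far. The list `cands` holds negated
multiples of the present coordinates of linear forms that are nonnegative on the first tetrahedron;
they come from the planes between consecutive tetrahedra, and three of them suffice. At every
vertex some form has to be nonpositive on the present tetrahedron. -/
def dfs : ℕ → List (Fin 4) → ℕ → ℕ → ℕ → List Vec → Bool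
  | 0, _, _, _, _, _ => false
  | n + 1, rev, vis, v, mx, cands =>
    [0, 1, 2, 3].all fun i : Fin 4 =>
      if mx < i.val then true
      else if vis.testBit (v ^^^ 2 ^ i.val) then true
      else
        let old := cands.map (fun c => c.act i)
        -- Reflections are involutions, so folding over `rev` leads from the present tetrahedron
        -- back to the first. The fold thus gives, up to a positive factor, the values there of the
        -- form with values `Vec.unit i` here. After the flip its values are `-Vec.unit i`, so its
        -- negation is stored as `Vec.unit i`.
        let new := if cands.length.blt 3 && (rev.foldl Vec.act (Vec.unit i)).nonneg then
          Vec.unit i :: old else old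
        new.any Vec.nonneg &&
          dfs n (i :: rev) (vis ||| 2 ^ (v ^^^ 2 ^ i.val)) (v ^^^ 2 ^ i.val) (max mx (i.val + 1)) new

/-- A self-avoiding walk on 16 vertices makes at most 15 flips, so the fuel does not run out. The
initial bit set `1` marks the starting vertex 0 as visited. -/
theorem dfs_true : dfs 17 [] 1 0 0 [] = true := by decide +kernel

/-! ### Reflections of tetrahedra -/

/-- Replace the `a`-th of four points by its mirror image in the plane of the other three, when
the four points are the vertices of a regular tetrahedron. -/
noncomputable def refl {M : Type*} [AddCommGroup M] [Module ℝ M] (a : Fin 4) (p : Fin 4 → M) :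
    Fin 4 → M :=
  Function.update p a ((2 / 3 : ℝ) • ∑ k, p k - (5 / 3 : ℝ) • p a)

/-- Successive reflections. -/
noncomputable def develop {M : Type*} [AddCommGroup M] [Module ℝ M] (w : List (Fin 4))
    (p : Fin 4 → M) : Fin 4 → M :=
  w.foldl (fun p a => refl a p) p

section refl

variable {M N : Type*} [AddCommGroup M] [Module ℝ M] [AddCommGroup N] [Module ℝ N]

theorem refl_self (a : Fin 4) (p : Fin 4 → M) :
    refl a p a = (2 / 3 : ℝ) • ∑ k, p k - (5 / 3 : ℝ) • p a := by
  simp [refl]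

theorem refl_of_ne {a k : Fin 4} (h : k ≠ a) (p : Fin 4 → M) : refl a p k = p k := by
  simp [refl, h]

theorem sum_refl (a : Fin 4) (p : Fin 4 → M) :
    ∑ k, refl a p k = (5 / 3 : ℝ) • ∑ k, p k - (8 / 3 : ℝ) • p a := by
  have h1 := Finset.add_sum_erase Finset.univ (refl a p) (Finset.mem_univ a)
  have h2 := Finset.add_sum_erase Finset.univ p (Finset.mem_univ a)
  have h3 : ∑ k ∈ Finset.univ.erase a, refl a p k = ∑ k ∈ Finset.univ.erase a, p k :=
    Finset.sum_congr rfl fun k hk => refl_of_ne (Finset.ne_of_mem_erase hk) p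
  rw [← h1, h3, refl_self, ← h2]
  module

theorem refl_refl (a : Fin 4) (p : Fin 4 → M) : refl a (refl a p) = p := by
  funext k
  by_cases h : k = a
  · subst h
    rw [refl_self, sum_refl, refl_self]
    module
  · rw [refl_of_ne h, refl_of_ne h]

theorem refl_smul (a : Fin 4) (t : ℝ) (p : Fin 4 → M) : refl a (t • p) = t • refl a p := by
  funext k
  by_cases h : k = a
  · subst h
    simp only [refl_self, Pi.smul_apply, ← Finset.smul_sum]
    module
  · simp [refl_of_ne h]

theorem refl_comp_perm (a : Fin 4) (σ : Equiv.Perm (Fin 4)) (p : Fin 4 → M) :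
    refl a (p ∘ σ) = refl (σ a) p ∘ σ := by
  funext k
  by_cases h : k = a
  · subst h
    simp only [refl_self, Function.comp_apply, Equiv.sum_comp σ p]
  · have : σ k ≠ σ a := fun e => h (σ.injective e)
    simp [refl_of_ne h, refl_of_ne this]

/-- The coefficients of the new vertex sum to `4 * (2 / 3) - 5 / 3 = 1`, so it is an affine
combination of the old ones. -/
theorem affineMap_refl (f : M →ᵃ[ℝ] N) (a : Fin 4) (p : Fin 4 → M) (k : Fin 4) :
    f (refl a p k) = refl a (fun j => f (p j)) k := by
  by_cases h : k = a
  · subst h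
    obtain ⟨g, b, key⟩ : ∃ (g : M →ₗ[ℝ] N) (b : N), ∀ x, f x = g x + b :=
      ⟨f.linear, f 0, fun x => by simpa using f.map_vadd 0 x⟩
    simp only [refl_self, key, map_sub, map_smul, map_sum, Finset.sum_add_distrib,
      Finset.sum_const, Finset.card_univ, Fintype.card_fin]
    module
  · simp [refl_of_ne h]

theorem affineMap_develop (f : M →ᵃ[ℝ] N) (w : List (Fin 4)) (p : Fin 4 → M) (k : Fin 4) :
    f (develop w p k) = develop w (fun j => f (p j)) k := by
  induction w generalizing p with
  | nil => rfl
  | cons a w ih =>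
    have h : (fun j => f (refl a p j)) = refl a (fun j => f (p j)) :=
      funext fun j => affineMap_refl f a p j
    change f (develop w (refl a p) k) = develop w (refl a _) k
    rw [ih, h]

theorem develop_append (w w' : List (Fin 4)) (p : Fin 4 → M) :
    develop (w ++ w') p = develop w' (develop w p) :=
  List.foldl_append

theorem develop_smul (w : List (Fin 4)) (t : ℝ) (p : Fin 4 → M) :
    develop w (t • p) = t • develop w p := by
  induction w generalizing p with
  | nil => rfl
  | cons a w ih =>
    change develop w (refl a _) = t • develop w (refl a p)
    rw [refl_smul, ih]

theorem develop_reverse_develop (w : List (Fin 4)) (p : Fin 4 → M) :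
    develop w.reverse (develop w p) = p := by
  induction w generalizing p with
  | nil => rfl
  | cons a w ih =>
    rw [List.reverse_cons, develop_append]
    change refl a (develop w.reverse (develop w (refl a p))) = p
    rw [ih, refl_refl]

theorem develop_comp_perm (w : List (Fin 4)) (σ : Equiv.Perm (Fin 4)) (p : Fin 4 → M) :
    develop w (p ∘ σ) = develop (w.map σ) p ∘ σ := by
  induction w generalizing p with
  | nil => rfl
  | cons a w ih =>
    change develop w (refl a _) = develop (w.map σ) (refl (σ a) p) ∘ σ
    rw [refl_comp_perm, ih]

end refl

/-! ### Separating functionals and soundness of the search -/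

/-- Some affine functional that is nonnegative and nonzero on a tetrahedron is nonpositive on its
image under the development along `w`. -/
def Separated (w : List (Fin 4)) : Prop :=
  ∃ c : Fin 4 → ℝ, 0 ≤ c ∧ c ≠ 0 ∧ develop w c ≤ 0

theorem Separated.of_map {w : List (Fin 4)} {σ : Equiv.Perm (Fin 4)}
    (h : Separated (w.map σ)) : Separated w := by
  obtain ⟨c, h0, h1, h2⟩ := h
  refine ⟨c ∘ σ, fun k => h0 (σ k), fun h => h1 ?_, ?_⟩
  · funext k
    simpa using congrFun h (σ.symm k)
  · rw [develop_comp_perm]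
    exact fun k => h2 (σ k)

def Vec.toFun (v : Vec) : Fin 4 → ℝ := ![v.a, v.b, v.c, v.d]

theorem Vec.toFun_act (v : Vec) (i : Fin 4) : (v.act i).toFun = (3 : ℝ) • refl i v.toFun := by
  funext j
  fin_cases i <;> fin_cases j <;>
    simp [Vec.toFun, Vec.act, refl, Function.update, Fin.sum_univ_four] <;> ring

theorem Vec.toFun_unit (i : Fin 4) : (Vec.unit i).toFun = Pi.single i 1 := by
  funext j
  fin_cases i <;> fin_cases j <;> simp [Vec.toFun, Vec.unit]

theorem nonneg_of_nonneg {x : ℤ} (h : nonneg x = true) : (0 : ℝ) ≤ x := by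
  cases x with
  | ofNat n => simp
  | negSucc n => simp [nonneg] at h

theorem Vec.toFun_nonneg {v : Vec} (h : v.nonneg = true) : 0 ≤ v.toFun := by
  simp only [Vec.nonneg, Bool.and_eq_true] at h
  obtain ⟨⟨⟨ha, hb⟩, hc⟩, hd⟩ := h
  intro j
  fin_cases j
  · exact nonneg_of_nonneg ha
  · exact nonneg_of_nonneg hb
  · exact nonneg_of_nonneg hc
  · exact nonneg_of_nonneg hd

theorem Vec.toFun_foldl (w : List (Fin 4)) (v : Vec) :
    ∃ t : ℝ, 0 < t ∧ (w.foldl Vec.act v).toFun = t • develop w v.toFun := by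
  induction w generalizing v with
  | nil => exact ⟨1, one_pos, by simp [develop]⟩
  | cons a w ih =>
    obtain ⟨t, ht, h⟩ := ih (v.act a)
    refine ⟨t * 3, by positivity, ?_⟩
    change (w.foldl Vec.act (v.act a)).toFun = _ • develop w (refl a v.toFun)
    rw [h, Vec.toFun_act, develop_smul, smul_smul]

/-- `v` is a negative multiple of the image under `develop rev.reverse` of a nonnegative nonzero
vector. -/
def IsCandidate (rev : List (Fin 4)) (v : Vec) : Prop :=
  ∃ c : Fin 4 → ℝ, 0 ≤ c ∧ c ≠ 0 ∧ ∃ t : ℝ, 0 < t ∧ v.toFun = -(t • develop rev.reverse c)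

theorem IsCandidate.act {rev : List (Fin 4)} {v : Vec} (h : IsCandidate rev v) (i : Fin 4) :
    IsCandidate (i :: rev) (v.act i) := by
  obtain ⟨c, h0, h1, t, ht, h⟩ := h
  refine ⟨c, h0, h1, 3 * t, by positivity, ?_⟩
  rw [Vec.toFun_act, h, List.reverse_cons, develop_append, ← neg_smul, refl_smul, smul_smul,
    ← neg_smul, mul_neg]
  rfl

/-- The plane of the face crossed by the flip: the form vanishes on that face, and its value at
vertex `i` goes from `1` to `2 / 3 - 5 / 3 = -1`. The hypothesis says that it is nonnegative on the
first tetrahedron. -/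
theorem isCandidate_unit {rev : List (Fin 4)} {i : Fin 4}
    (h : (rev.foldl Vec.act (Vec.unit i)).nonneg = true) :
    IsCandidate (i :: rev) (Vec.unit i) := by
  obtain ⟨t, ht, e⟩ := Vec.toFun_foldl rev (Vec.unit i)
  have hd := develop_reverse_develop rev (Vec.unit i).toFun
  refine ⟨develop rev (Vec.unit i).toFun, ?_, ?_, 1, one_pos, ?_⟩
  · have h' := Vec.toFun_nonneg h
    rw [e] at h'
    intro k
    exact nonneg_of_mul_nonneg_right (h' k) ht
  · intro h0
    rw [h0, ← zero_smul ℝ (0 : Fin 4 → ℝ), develop_smul, zero_smul, Vec.toFun_unit] at hd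
    simpa using congrFun hd i
  · rw [List.reverse_cons, develop_append, hd, one_smul, Vec.toFun_unit]
    change _ = -refl i (Pi.single i 1)
    funext k
    by_cases hk : k = i
    · subst hk
      norm_num [refl_self]
    · simp [refl_of_ne hk, hk]

theorem IsCandidate.separated {rev : List (Fin 4)} {v : Vec} (h : IsCandidate rev v)
    (hv : v.nonneg = true) : Separated rev.reverse := by
  obtain ⟨c, h0, h1, t, ht, h⟩ := h
  refine ⟨c, h0, h1, fun k => ?_⟩
  have h2 := Vec.toFun_nonneg hv k
  rw [h] at h2
  simp only [Pi.zero_apply, Pi.neg_apply, Pi.smul_apply, smul_eq_mul] at h2 ⊢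
  nlinarith

/-- The letters of `w` make their first appearances in increasing order, after `m` letters. -/
def Canonical : ℕ → List (Fin 4) → Prop
  | _, [] => True
  | m, a :: w => a.val ≤ m ∧ Canonical (max m (a.val + 1)) w

/-- Each new letter is renamed to the least unused one. Requiring `σ` to fix the letters below `m`
keeps later renamings from disturbing earlier ones; `τ` accumulates the renamings already made. -/
theorem exists_canonical_map (w : List (Fin 4)) (m : ℕ) (τ : Equiv.Perm (Fin 4)) :
    ∃ σ : Equiv.Perm (Fin 4), (∀ i : Fin 4, i.val < m → σ i = i) ∧
      Canonical m (w.map (σ * τ)) := by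
  induction w generalizing m τ with
  | nil => exact ⟨1, by simp, trivial⟩
  | cons a w ih =>
    by_cases h : (τ a).val < m
    · obtain ⟨σ, h1, h2⟩ := ih m τ
      refine ⟨σ, h1, ?_⟩
      rw [List.map_cons, Equiv.Perm.mul_apply, h1 _ h]
      exact ⟨h.le, by rwa [max_eq_left h]⟩
    · have hm : m < 4 := by omega
      let b : Fin 4 := ⟨m, hm⟩
      obtain ⟨σ, h1, h2⟩ := ih (m + 1) (Equiv.swap (τ a) b * τ)
      have hb : σ b = b := h1 b (Nat.lt_succ_self m)
      refine ⟨σ * Equiv.swap (τ a) b, fun i hi => ?_, ?_⟩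
      · have hia : i ≠ τ a := fun e => h (e ▸ hi)
        have hib : i ≠ b := fun e => by simp [e, b] at hi
        rw [Equiv.Perm.mul_apply, Equiv.swap_apply_of_ne_of_ne hia hib]
        exact h1 i (by omega)
      · rw [mul_assoc, List.map_cons]
        have hab : (σ * (Equiv.swap (τ a) b * τ)) a = b := by simp [hb]
        rw [hab]
        exact ⟨le_rfl, by simpa [b] using h2⟩

def natTrace : ℕ → List (Fin 4) → List ℕ
  | _, [] => []
  | v, a :: w => (v ^^^ 2 ^ a.val) :: natTrace (v ^^^ 2 ^ a.val) w

/-- Induction on the fuel, following the branch of the search prescribed by `w`. The word must be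
nonempty because candidates are tested only after a flip. -/
theorem separated_of_dfs {n : ℕ} {rev : List (Fin 4)} {vis v mx : ℕ} {cands : List Vec}
    (h : dfs n rev vis v mx cands = true) (hc : ∀ c ∈ cands, IsCandidate rev c)
    {w : List (Fin 4)} (hw : w ≠ []) (hcan : Canonical mx w) (hnd : (natTrace v w).Nodup)
    (hvis : ∀ q ∈ natTrace v w, vis.testBit q = false) : Separated (rev.reverse ++ w) := by
  induction n generalizing rev vis v mx cands w with
  | zero => simp [dfs] at h
  | succ n ih =>
    obtain _ | ⟨a, w⟩ := w
    · exact absurd rfl hw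
    rw [dfs, List.all_eq_true] at h
    have ha := h a (by fin_cases a <;> simp)
    have h1 : ¬ mx < a.val := not_lt.2 hcan.1
    have h2 := hvis (v ^^^ 2 ^ a.val) (by simp [natTrace])
    rw [if_neg h1, if_neg (by simp [h2])] at ha
    set new := (if (cands.length.blt 3 && (rev.foldl Vec.act (Vec.unit a)).nonneg) = true then
      Vec.unit a :: cands.map (fun c => c.act a) else cands.map (fun c => c.act a)) with hnew
    rw [Bool.and_eq_true] at ha
    have hold : ∀ c ∈ cands.map (fun c => c.act a), IsCandidate (a :: rev) c := by
      intro c hmem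
      obtain ⟨c', hc', rfl⟩ := List.mem_map.1 hmem
      exact (hc c' hc').act a
    have hcn : ∀ c ∈ new, IsCandidate (a :: rev) c := by
      intro c hmem
      rw [hnew] at hmem
      split_ifs at hmem with hs
      · obtain rfl | hmem := List.mem_cons.1 hmem
        · exact isCandidate_unit (Bool.and_eq_true_iff.1 hs).2
        · exact hold c hmem
      · exact hold c hmem
    have hrev : rev.reverse ++ a :: w = (a :: rev).reverse ++ w := by simp
    rw [hrev]
    by_cases hw' : w = []
    · subst hw'
      rw [List.append_nil]
      obtain ⟨c, hmem, hpos⟩ := List.any_eq_true.1 ha.1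
      exact (hcn c hmem).separated hpos
    · rw [natTrace, List.nodup_cons] at hnd
      refine ih ha.2 hcn hw' hcan.2 hnd.2 fun q hq => ?_
      rw [Nat.testBit_or, hvis q (by simp [natTrace, hq]), Nat.testBit_two_pow]
      have : v ^^^ 2 ^ a.val ≠ q := fun e => hnd.1 (e ▸ hq)
      simp [this]

/-! ### Words of flips as walks in the 4-cube -/

/-- Flip one sign. -/
def toggle (a : Fin 4) (ε : Fin 4 → Bool) : Fin 4 → Bool :=
  Function.update ε a (!ε a)

/-- The sign vectors visited by a word of flips, without the starting one. -/
def trace : (Fin 4 → Bool) → List (Fin 4) → List (Fin 4 → Bool)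
  | _, [] => []
  | ε, a :: w => toggle a ε :: trace (toggle a ε) w

theorem map_trace {f : (Fin 4 → Bool) → (Fin 4 → Bool)} {σ : Fin 4 → Fin 4}
    (hf : ∀ a ε, f (toggle a ε) = toggle (σ a) (f ε)) (ε : Fin 4 → Bool) (w : List (Fin 4)) :
    (trace ε w).map f = trace (f ε) (w.map σ) := by
  induction w generalizing ε with
  | nil => rfl
  | cons a w ih => simp [trace, ih, hf]

def code (ε : Fin 4 → Bool) : ℕ :=
  (ε 0).toNat + 2 * (ε 1).toNat + 4 * (ε 2).toNat + 8 * (ε 3).toNat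

theorem code_injective : Function.Injective code := by
  unfold Function.Injective
  decide +kernel

theorem code_toggle : ∀ (a : Fin 4) (ε : Fin 4 → Bool),
    code (toggle a ε) = code ε ^^^ 2 ^ a.val := by
  decide +kernel

theorem map_code_trace (ε : Fin 4 → Bool) (w : List (Fin 4)) :
    (trace ε w).map code = natTrace (code ε) w := by
  induction w generalizing ε with
  | nil => rfl
  | cons a w ih => simp [trace, natTrace, ih, code_toggle]

theorem separated_of_nodup {ε : Fin 4 → Bool} {w : List (Fin 4)} (hw : w ≠ [])
    (h : (ε :: trace ε w).Nodup) : Separated w := by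
  obtain ⟨σ, -, hcan⟩ := exists_canonical_map w 0 1
  rw [mul_one] at hcan
  -- The cube symmetry that renames coordinates by `σ` and moves the start `ε` to the zero vertex,
  -- where the search begins.
  let f : (Fin 4 → Bool) → (Fin 4 → Bool) := fun ε' k => xor (ε' (σ.symm k)) (ε (σ.symm k))
  have hf : ∀ a ε', f (toggle a ε') = toggle (σ a) (f ε') := by
    intro a ε'
    funext k
    by_cases hk : k = σ a
    · subst hk
      simp [f, toggle]
    · have : σ.symm k ≠ a := fun e => hk (by simp [← e])
      simp [f, toggle, hk, this]
  have hfinj : Function.Injective f := by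
    intro x y hxy
    funext k
    simpa [f] using congrFun hxy (σ k)
  have hf0 : code (f ε) = 0 := by simp [f, code]
  have key : ((ε :: trace ε w).map (code ∘ f)).Nodup := h.map (code_injective.comp hfinj)
  rw [← List.map_map, List.map_cons, map_trace hf, List.map_cons, map_code_trace, hf0,
    List.nodup_cons] at key
  refine Separated.of_map (σ := σ) ?_
  refine separated_of_dfs (rev := []) dfs_true (by simp) (by simpa using hw) hcan key.2 ?_
  intro q hq
  have : q ≠ 0 := fun e => key.1 (e ▸ hq)
  rwa [← Bool.not_eq_true, Nat.testBit_one_eq_true_iff_self_eq_zero]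

/-! ### Regular tetrahedra -/

/-- The points `p k` are the vertices of a regular tetrahedron with edges of length `√2`. -/
def IsRegular {E : Type*} [NormedAddCommGroup E] [NormedSpace ℝ E] (p : Fin 4 → E) : Prop :=
  ∀ t : Fin 4 → ℝ, ∑ k, t k = 0 → ‖∑ k, t k • p k‖ ^ 2 = ∑ k, t k ^ 2

/-- Moves the reflection from the points to the weights, where regularity becomes an identity
between quadratic forms. -/
theorem sum_smul_refl {E : Type*} [AddCommGroup E] [Module ℝ E] (a : Fin 4) (t : Fin 4 → ℝ)
    (p : Fin 4 → E) :
    ∑ k, t k • refl a p k =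
      ∑ k, (t k + (2 / 3) * t a - if k = a then (8 / 3) * t a else 0) • p k := by
  simp only [sub_smul, add_smul, Finset.sum_sub_distrib, Finset.sum_add_distrib, ite_smul,
    zero_smul, Finset.sum_ite_eq', Finset.mem_univ, if_true]
  rw [← Finset.smul_sum]
  have h1 := Finset.add_sum_erase Finset.univ (fun k => t k • refl a p k) (Finset.mem_univ a)
  have h2 := Finset.add_sum_erase Finset.univ (fun k => t k • p k) (Finset.mem_univ a)
  have h3 : ∑ k ∈ Finset.univ.erase a, t k • refl a p k =
      ∑ k ∈ Finset.univ.erase a, t k • p k :=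
    Finset.sum_congr rfl fun k hk => by rw [refl_of_ne (Finset.ne_of_mem_erase hk)]
  rw [← h1, h3, ← h2, refl_self]
  module

section

variable {E : Type*} [NormedAddCommGroup E] [NormedSpace ℝ E] {p : Fin 4 → E}

theorem IsRegular.refl (h : IsRegular p) (a : Fin 4) : IsRegular (refl a p) := by
  intro t ht
  rw [sum_smul_refl, h]
  · rw [Fin.sum_univ_four] at ht ⊢
    rw [Fin.sum_univ_four]
    fin_cases a <;> simp
    · have : t 0 = -(t 1 + t 2 + t 3) := by linarith
      rw [this]; ring
    · have : t 1 = -(t 0 + t 2 + t 3) := by linarith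
      rw [this]; ring
    · have : t 2 = -(t 0 + t 1 + t 3) := by linarith
      rw [this]; ring
    · have : t 3 = -(t 0 + t 1 + t 2) := by linarith
      rw [this]; ring
  · simp only [Finset.sum_sub_distrib, Finset.sum_add_distrib, ht, Finset.sum_ite_eq',
      Finset.mem_univ, if_true, Finset.sum_const, Finset.card_univ, Fintype.card_fin]
    simp only [nsmul_eq_mul]
    push_cast
    ring

theorem IsRegular.develop (h : IsRegular p) (w : List (Fin 4)) : IsRegular (develop w p) := by
  induction w generalizing p with
  | nil => exact h
  | cons a w ih => exact ih (h.refl a)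

theorem IsRegular.affineIndependent (h : IsRegular p) : AffineIndependent ℝ p := by
  rw [affineIndependent_iff_of_fintype]
  intro t ht h0 i
  rw [Finset.univ.weightedVSub_eq_linear_combination ht] at h0
  have h1 := h t ht
  rw [h0, norm_zero, zero_pow two_ne_zero, eq_comm,
    Finset.sum_eq_zero_iff_of_nonneg fun _ _ => sq_nonneg _] at h1
  exact pow_eq_zero_iff two_ne_zero |>.1 (h1 i (Finset.mem_univ i))

theorem IsRegular.dist_sq (h : IsRegular p) {t s : Fin 4 → ℝ} (hts : ∑ k, t k = ∑ k, s k) :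
    dist (∑ k, t k • p k) (∑ k, s k • p k) ^ 2 = ∑ k, (t k - s k) ^ 2 := by
  rw [dist_eq_norm, ← Finset.sum_sub_distrib, ← h (fun k => t k - s k)]
  · simp only [sub_smul]
  · rw [Finset.sum_sub_distrib, hts, sub_self]

end

/-- For weights of sum zero the squared norm is `-1/2` times the sum of `t j * t k * dist ^ 2`; the
off-diagonal products sum to `-∑ t k ^ 2`. -/
theorem isRegular_of_dist {E : Type*} [NormedAddCommGroup E] [InnerProductSpace ℝ E]
    {p : Fin 4 → E} (h : ∀ j k, j ≠ k → dist (p j) (p k) ^ 2 = 2) : IsRegular p := by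
  intro t ht
  have h1 := EuclideanGeometry.inner_weightedVSub (s₁ := Finset.univ) (s₂ := Finset.univ)
    (w₁ := t) (w₂ := t) p ht p ht
  rw [Finset.univ.weightedVSub_eq_linear_combination ht, real_inner_self_eq_norm_sq] at h1
  rw [h1]
  have h2 : ∀ j k, t j * t k * (dist (p j) (p k) * dist (p j) (p k)) =
      2 * t j * t k - if j = k then 2 * t j * t k else 0 := by
    intro j k
    by_cases hjk : j = k
    · simp [hjk]
    · rw [← pow_two, h j k hjk, if_neg hjk]
      ring
  simp only [h2, Finset.sum_sub_distrib, Finset.sum_ite_eq, Finset.mem_univ, if_true,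
    ← Finset.mul_sum, ht, mul_zero, zero_sub]
  rw [← Finset.sum_neg_distrib, Finset.sum_div]
  exact Finset.sum_congr rfl fun k _ => by ring

section

variable {p : Fin 4 → EuclideanSpace ℝ (Fin 3)}

/-- The vertices of a regular tetrahedron as an affine basis of three-space. -/
noncomputable def IsRegular.basis (h : IsRegular p) :
    AffineBasis (Fin 4) ℝ (EuclideanSpace ℝ (Fin 3)) where
  toFun := p
  ind' := h.affineIndependent
  tot' := by
    rw [h.affineIndependent.affineSpan_eq_top_iff_card_eq_finrank_add_one]
    simp

theorem IsRegular.coe_basis (h : IsRegular p) : ⇑h.basis = p := rfl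

/-- Reflection in the opposite face is the only way to attach a second regular tetrahedron to
a face of a given one. -/
theorem IsRegular.eq_refl (hp : IsRegular p) {q : Fin 4 → EuclideanSpace ℝ (Fin 3)}
    (hq : IsRegular q) {a : Fin 4} (h : ∀ k, k ≠ a → q k = p k) (ha : q a ≠ p a) :
    q = RidgeUnfold.refl a p := by
  let l : Fin 4 → ℝ := fun k => hp.basis.coord k (q a)
  have hl1 : ∑ k, l k = 1 := hp.basis.sum_coord_apply_eq_one (q a)
  have hl : ∑ k, l k • p k = q a := hp.basis.linear_combination_coord_eq_self (q a)
  have hsingle : ∀ (r : Fin 4 → EuclideanSpace ℝ (Fin 3)) (j : Fin 4),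
      ∑ k, (Pi.single j 1 : Fin 4 → ℝ) k • r k = r j := by
    intro r j
    simp [Pi.single_apply]
  have hs1 : ∀ j : Fin 4, ∑ k, (Pi.single j 1 : Fin 4 → ℝ) k = 1 := by simp
  have hd : ∀ j, j ≠ a → ∑ k, (l k - (Pi.single j 1 : Fin 4 → ℝ) k) ^ 2 = 2 := by
    intro j hj
    rw [← hp.dist_sq (hl1.trans (hs1 j).symm), hl, hsingle, ← h j hj, ← hsingle q a,
      ← hsingle q j, hq.dist_sq ((hs1 a).trans (hs1 j).symm)]
    simp only [Fin.sum_univ_four]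
    fin_cases a <;> fin_cases j <;> simp at hj ⊢ <;> norm_num
  have hval : (∀ k, k ≠ a → l k = 2 / 3) ∧ l a = -1 := by
    have hne : ¬ ((∀ k, k ≠ a → l k = 0) ∧ l a = 1) := by
      rintro ⟨h0, h1⟩
      apply ha
      rw [← hl, Finset.sum_eq_single a (fun k _ hk => by rw [h0 k hk, zero_smul]) (by simp), h1,
        one_smul]
    -- Squared distance 2 to each `p j` with `j ≠ a` forces the barycentric coordinate `l j` of `q
    -- a` to be this common value. The sum condition then leaves a quadratic with roots `0`, which
    -- is `p a` itself, and `2 / 3`, which is the mirror image.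
    obtain ⟨μ, hμ⟩ : ∃ μ, μ = (∑ k, l k ^ 2 - 1) / 2 := ⟨_, rfl⟩
    have hlμ : ∀ j, j ≠ a → l j = μ := by
      intro j hj
      have h1 : ∑ k, (l k - (Pi.single j 1 : Fin 4 → ℝ) k) ^ 2 = ∑ k, l k ^ 2 - 2 * l j + 1 := by
        simp only [Fin.sum_univ_four]
        fin_cases j <;> simp <;> ring
      rw [hd j hj] at h1
      linarith
    have herase : ∀ f : Fin 4 → ℝ, ∀ c : ℝ, (∀ j, j ≠ a → f j = c) → ∑ k, f k = f a + 3 * c := by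
      intro f c hf
      rw [← Finset.add_sum_erase Finset.univ f (Finset.mem_univ a),
        Finset.sum_congr rfl fun j hj => hf j (Finset.ne_of_mem_erase hj)]
      simp
    have h1 := herase l μ hlμ
    rw [hl1] at h1
    rw [herase (fun k => l k ^ 2) (μ ^ 2) fun j hj => by rw [hlμ j hj]] at hμ
    have hla : l a = 1 - 3 * μ := by linarith
    rw [hla] at hμ
    have h2 : μ * (μ - 2 / 3) = 0 := by linear_combination -hμ / 6
    obtain h2 | h2 := mul_eq_zero.1 h2
    · exact absurd ⟨fun k hk => (hlμ k hk).trans h2, by rw [hla, h2]; norm_num⟩ hne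
    · have h3 : μ = 2 / 3 := by linarith
      exact ⟨fun k hk => (hlμ k hk).trans h3, by rw [hla, h3]; norm_num⟩
  funext k
  by_cases hk : k = a
  · subst hk
    rw [refl_self, ← hl]
    have h1 := Finset.add_sum_erase Finset.univ p (Finset.mem_univ k)
    have h2 := Finset.add_sum_erase Finset.univ (fun j => l j • p j) (Finset.mem_univ k)
    have h3 : ∑ j ∈ Finset.univ.erase k, l j • p j =
        (2 / 3 : ℝ) • ∑ j ∈ Finset.univ.erase k, p j := by
      rw [Finset.smul_sum]
      exact Finset.sum_congr rfl fun j hj => by rw [hval.1 j (Finset.ne_of_mem_erase hj)]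
    rw [← h1, ← h2, h3, hval.2]
    module
  · rw [h k hk, refl_of_ne hk]

/-- The certificate `c` extends affinely to a functional that is positive where all barycentric
coordinates are positive, and nonpositive on the developed tetrahedron. -/
theorem IsRegular.disjoint_interior (h : IsRegular p) {w : List (Fin 4)} (hw : Separated w) :
    Disjoint (interior (convexHull ℝ (Set.range p)))
      (interior (convexHull ℝ (Set.range (RidgeUnfold.develop w p)))) := by
  obtain ⟨c, h0, h1, h2⟩ := hw
  let f : EuclideanSpace ℝ (Fin 3) →ᵃ[ℝ] ℝ := ∑ k, c k • h.basis.coord k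
  have hf : ∀ x, f x = ∑ k, c k * h.basis.coord k x := by
    intro x
    have : ∀ s : Finset (Fin 4), (∑ k ∈ s, c k • h.basis.coord k) x =
        ∑ k ∈ s, c k * h.basis.coord k x := by
      intro s
      induction s using Finset.induction_on with
      | empty => simp
      | insert k s hk ih => simp [Finset.sum_insert hk, ih]
    exact this _
  have hfp : (fun k => f (p k)) = c := by
    funext k
    rw [hf]
    have : ∀ j, h.basis.coord j (p k) = if j = k then 1 else 0 := fun j =>
      h.basis.coord_apply j k
    simp [this]
  rw [Set.disjoint_left]
  intro x hx hx'
  rw [← h.coe_basis, AffineBasis.interior_convexHull] at hx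
  have hpos : 0 < f x := by
    rw [hf]
    obtain ⟨k, hk⟩ := Function.ne_iff.1 h1
    exact Finset.sum_pos' (fun i _ => mul_nonneg (h0 i) (hx i).le)
      ⟨k, Finset.mem_univ k, mul_pos (lt_of_le_of_ne (h0 k) (Ne.symm hk)) (hx k)⟩
  have hsub : convexHull ℝ (Set.range (RidgeUnfold.develop w p)) ⊆ f ⁻¹' Set.Iic 0 := by
    refine convexHull_min ?_ ((convex_Iic (0 : ℝ)).affine_preimage f)
    rintro _ ⟨k, rfl⟩
    change f _ ≤ 0
    rw [affineMap_develop, hfp]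
    exact h2 k
  exact absurd (hsub (interior_subset hx')) (not_le.2 hpos)

end

/-! ### Facets and ridges of the orthoplex -/

/-- The real number `1` or `-1`. -/
def sgn (b : Bool) : ℝ := if b then 1 else -1

theorem sgn_mul_self (b : Bool) : sgn b * sgn b = 1 := by
  cases b <;> simp [sgn]

theorem sgn_not (b : Bool) : sgn (!b) = -sgn b := by
  cases b <;> simp [sgn]

theorem sgn_mul_sgn_mul (b : Bool) (x : ℝ) : sgn b * (sgn b * x) = x := by
  rw [← mul_assoc, sgn_mul_self, one_mul]

theorem abs_sgn_mul (b : Bool) (x : ℝ) : |sgn b * x| = |x| := by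
  cases b <;> simp [sgn]

/-- The facet of the orthoplex in the orthant with signs `ε`. -/
def facetSet (ε : Fin 4 → Bool) : Set (EuclideanSpace ℝ (Fin 4)) :=
  {x | (∀ k, 0 ≤ sgn (ε k) * x k) ∧ ∑ k, sgn (ε k) * x k = 1}

/-- The `k`-th vertex of `facetSet ε`. -/
noncomputable def vertex (ε : Fin 4 → Bool) (k : Fin 4) : EuclideanSpace ℝ (Fin 4) :=
  EuclideanSpace.single k (sgn (ε k))

theorem vertex_apply (ε : Fin 4 → Bool) (k j : Fin 4) :
    vertex ε k j = if j = k then sgn (ε k) else 0 := by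
  simp [vertex]

theorem vertex_mem (ε : Fin 4 → Bool) (k : Fin 4) : vertex ε k ∈ facetSet ε := by
  refine ⟨fun j => ?_, ?_⟩
  · rw [vertex_apply]
    split_ifs with h
    · rw [h, sgn_mul_self]
      exact zero_le_one
    · simp
  · simp [vertex_apply, sgn_mul_self]

theorem sum_smul_vertex (ε : Fin 4 → Bool) (x : EuclideanSpace ℝ (Fin 4)) :
    ∑ k, (sgn (ε k) * x k) • vertex ε k = x := by
  ext j
  have : ∀ k : Fin 4, sgn (ε k) * x k * (if j = k then sgn (ε k) else 0) =
      if j = k then x k else 0 := by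
    intro k
    split_ifs
    · rw [mul_comm, sgn_mul_sgn_mul]
    · simp
  simp [vertex_apply, this]

theorem facetSet_eq_convexHull (ε : Fin 4 → Bool) :
    facetSet ε = convexHull ℝ (Set.range (vertex ε)) := by
  apply Set.Subset.antisymm
  · intro x hx
    exact mem_convexHull_of_exists_fintype (fun k => sgn (ε k) * x k) (vertex ε) hx.1 hx.2
      (fun k => Set.mem_range_self k) (sum_smul_vertex ε x)
  · refine convexHull_min ?_ ?_
    · rintro _ ⟨k, rfl⟩
      exact vertex_mem ε k
    · intro x hx y hy a b ha hb hab
      have h : ∀ k, sgn (ε k) * (a • x + b • y) k =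
          a * (sgn (ε k) * x k) + b * (sgn (ε k) * y k) := by
        intro k
        simp
        ring
      refine ⟨fun k => ?_, ?_⟩
      · rw [h]
        have := mul_nonneg ha (hx.1 k)
        have := mul_nonneg hb (hy.1 k)
        linarith
      · simp only [h, Finset.sum_add_distrib, ← Finset.mul_sum, hx.2, hy.2, mul_one, hab]

theorem vertex_mem_orthoplex (ε : Fin 4 → Bool) (k : Fin 4) : vertex ε k ∈ orthoplex 4 := by
  apply subset_convexHull
  rw [vertex]
  cases ε k
  · right
    refine ⟨k, ?_⟩
    ext j
    by_cases h : j = k <;> simp [sgn, h]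
  · left
    exact ⟨k, by simp [sgn]⟩

theorem facetSet_subset (ε : Fin 4 → Bool) : facetSet ε ⊆ orthoplex 4 := by
  rw [facetSet_eq_convexHull]
  refine convexHull_min ?_ (convex_convexHull ℝ _)
  rintro _ ⟨k, rfl⟩
  exact vertex_mem_orthoplex ε k

theorem sum_abs_le_one {x : EuclideanSpace ℝ (Fin 4)} (hx : x ∈ orthoplex 4) :
    ∑ k, |x k| ≤ 1 := by
  have h : orthoplex 4 ⊆ {x : EuclideanSpace ℝ (Fin 4) | ∑ k, |x k| ≤ 1} := by
    refine convexHull_min ?_ ?_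
    · rintro _ (⟨k, rfl⟩ | ⟨k, rfl⟩) <;> simp [apply_ite abs]
    · intro x hx y hy a b ha hb hab
      have h1 : ∀ k, |(a • x + b • y) k| ≤ a * |x k| + b * |y k| := by
        intro k
        have := abs_add_le (a * x k) (b * y k)
        rwa [abs_mul, abs_mul, abs_of_nonneg ha, abs_of_nonneg hb] at this
      have h2 := Finset.sum_le_sum fun k (_ : k ∈ Finset.univ) => h1 k
      rw [Finset.sum_add_distrib, ← Finset.mul_sum, ← Finset.mul_sum] at h2
      have h3 := mul_le_mul_of_nonneg_left hx ha
      have h4 := mul_le_mul_of_nonneg_left hy hb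
      change ∑ k, |(a • x + b • y) k| ≤ 1
      linarith
  exact h hx

/-- Such an `S` lies in the simplex on the vertices indexed by `A`. -/
theorem finrank_vectorSpan_add_one_le {ε : Fin 4 → Bool} {A : Finset (Fin 4)}
    {S : Set (EuclideanSpace ℝ (Fin 4))} (hS : S.Nonempty) (h : S ⊆ facetSet ε)
    (h0 : ∀ x ∈ S, ∀ k, k ∉ A → x k = 0) :
    Module.finrank ℝ (vectorSpan ℝ S) + 1 ≤ A.card := by
  have hsub : S ⊆ convexHull ℝ (Set.range fun k : A => vertex ε k) := by
    intro x hx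
    have hzero : ∀ k, k ∉ A → sgn (ε k) * x k = 0 := fun k hk => by rw [h0 x hx k hk, mul_zero]
    refine mem_convexHull_of_exists_fintype (fun k : A => sgn (ε k) * x k)
      (fun k : A => vertex ε k) (fun k => (h hx).1 k) ?_ (fun k => Set.mem_range_self k) ?_
    · rw [← (h hx).2, Finset.sum_coe_sort A fun k => sgn (ε k) * x k]
      exact Finset.sum_subset (Finset.subset_univ A) fun k _ hk => hzero k hk
    · rw [Finset.sum_coe_sort A fun k => (sgn (ε k) * x k) • vertex ε k]
      conv_rhs => rw [← sum_smul_vertex ε x]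
      exact Finset.sum_subset (Finset.subset_univ A) fun k _ hk => by rw [hzero k hk, zero_smul]
  have hne : Nonempty A := by
    by_contra hA
    rw [not_nonempty_iff] at hA
    obtain ⟨x, hx⟩ := hS
    simpa [Set.range_eq_empty] using hsub hx
  have hle : vectorSpan ℝ S ≤ vectorSpan ℝ (Set.range fun k : A => vertex ε k) := by
    rw [← direction_affineSpan, ← direction_affineSpan]
    apply AffineSubspace.direction_le
    rw [← affineSpan_convexHull (Set.range fun k : A => vertex ε k)]
    exact affineSpan_mono ℝ hsub
  have h1 := finrank_vectorSpan_range_add_one_le ℝ (fun k : A => vertex ε k)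
  rw [Fintype.card_coe] at h1
  exact (Nat.succ_le_succ (Submodule.finrank_mono hle)).trans h1

theorem finrank_vectorSpan_orthoplex :
    Module.finrank ℝ (vectorSpan ℝ (orthoplex 4)) = 4 := by
  have : vectorSpan ℝ (orthoplex 4) = ⊤ := by
    rw [eq_top_iff]
    intro x _
    rw [← sum_smul_vertex (fun _ => true) x]
    refine Submodule.sum_mem _ fun k _ => Submodule.smul_mem _ _ ?_
    have h := vsub_mem_vectorSpan ℝ (vertex_mem_orthoplex (fun _ => true) k)
      (vertex_mem_orthoplex (fun _ => false) k)
    have h2 := Submodule.smul_mem _ (1 / 2 : ℝ) h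
    convert h2 using 1
    ext j
    by_cases hj : j = k <;> norm_num [vertex, sgn, hj]
  rw [this, finrank_top]
  simp

/-- A functional with coefficients `a k` is maximized only at points with the signs of `a` and
support where `|a k|` is largest. Dimension 3 forces all `|a k|` to be equal and nonzero. -/
theorem exists_eq_facetSet {F : Set (EuclideanSpace ℝ (Fin 4))}
    (hF : IsFaceOfDim (orthoplex 4) 3 F) : ∃ ε, F = facetSet ε := by
  obtain ⟨hexp, hne, hdim⟩ := hF
  obtain ⟨l, hl⟩ := hexp hne
  let a : Fin 4 → ℝ := fun k => l (EuclideanSpace.single k 1)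
  let ε : Fin 4 → Bool := fun k => decide (0 ≤ a k)
  have hεa : ∀ k, sgn (ε k) * a k = |a k| := by
    intro k
    by_cases h : 0 ≤ a k
    · simp [ε, sgn, h, abs_of_nonneg h]
    · simp [ε, sgn, h, abs_of_neg (not_le.1 h)]
  have hlv : ∀ k, l (vertex ε k) = |a k| := by
    intro k
    have : vertex ε k = sgn (ε k) • EuclideanSpace.single k (1 : ℝ) := by
      ext j
      simp [vertex]
    rw [this, map_smul, smul_eq_mul, hεa]
  have hlx : ∀ x, l x = ∑ k, sgn (ε k) * x k * |a k| := by
    intro x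
    conv_lhs => rw [← sum_smul_vertex ε x]
    simp [map_sum, hlv]
  obtain ⟨m, -, hm⟩ := Finset.exists_max_image Finset.univ (fun k => |a k|) ⟨0, Finset.mem_univ _⟩
  have hm : ∀ k, |a k| ≤ |a m| := fun k => hm k (Finset.mem_univ k)
  by_cases h0 : |a m| = 0
  · exfalso
    have hP : F = orthoplex 4 := by
      have hl0 : ∀ x, l x = 0 := fun x => by
        rw [hlx]
        refine Finset.sum_eq_zero fun k _ => ?_
        rw [le_antisymm ((hm k).trans h0.le) (abs_nonneg _), mul_zero]
      rw [hl]
      ext x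
      simp [hl0]
    rw [hP, finrank_vectorSpan_orthoplex] at hdim
    omega
  have hpos : 0 < |a m| := lt_of_le_of_ne (abs_nonneg _) (Ne.symm h0)
  have hsgn : ∀ (x : EuclideanSpace ℝ (Fin 4)) k, sgn (ε k) * x k ≤ |x k| := fun x k => by
    rw [← abs_sgn_mul (ε k)]
    exact le_abs_self _
  have key : ∀ x ∈ F, x ∈ facetSet ε ∧ ∀ k, |a k| ≠ |a m| → x k = 0 := by
    intro x hx
    rw [hl] at hx
    have h1 := hx.2 _ (vertex_mem_orthoplex ε m)
    rw [hlv, hlx] at h1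
    have h2 := sum_abs_le_one hx.1
    have h3 : ∀ k, sgn (ε k) * x k * |a k| ≤ |a m| * |x k| := by
      intro k
      have e1 := mul_le_mul_of_nonneg_right (hsgn x k) (abs_nonneg (a k))
      have e2 := mul_le_mul_of_nonneg_left (hm k) (abs_nonneg (x k))
      linarith
    have h4 : ∑ k, |a m| * |x k| ≤ |a m| := by
      rw [← Finset.mul_sum]
      nlinarith
    -- The chain `|a m| ≤ l x ≤ |a m| * ∑ |x k| ≤ |a m|` collapses, so equality holds term by term.
    have h5 : ∀ k, sgn (ε k) * x k * |a k| = |a m| * |x k| := fun k =>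
      (Finset.sum_eq_sum_iff_of_le fun k _ => h3 k).1
        (le_antisymm (Finset.sum_le_sum fun k _ => h3 k) (h4.trans h1)) k (Finset.mem_univ k)
    have h6 : ∀ k, sgn (ε k) * x k = |x k| := by
      intro k
      refine le_antisymm (hsgn x k) ?_
      by_contra hlt
      rw [not_le] at hlt
      by_cases hn : 0 ≤ sgn (ε k) * x k
      · have := mul_le_mul_of_nonneg_left (hm k) hn
        nlinarith [h5 k]
      · have hx0 : 0 ≤ |x k| := abs_nonneg _
        have h7 : sgn (ε k) * x k * |a k| ≤ 0 :=
          mul_nonpos_of_nonpos_of_nonneg (not_le.1 hn).le (abs_nonneg _)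
        have h8 : |x k| = 0 := by nlinarith [h5 k]
        have h9 : x k = 0 := abs_eq_zero.1 h8
        simp [h9] at hn
    refine ⟨⟨fun k => (h6 k).symm ▸ abs_nonneg _, ?_⟩, fun k hk => ?_⟩
    · refine le_antisymm ((Finset.sum_le_sum fun k _ => hsgn x k).trans h2) ?_
      rw [Finset.sum_congr rfl fun k _ => h5 k, ← Finset.mul_sum] at h1
      rw [Finset.sum_congr rfl fun k _ => h6 k]
      nlinarith
    · have h7 := h5 k
      rw [h6 k, mul_comm] at h7
      by_contra hxk
      exact hk (mul_right_cancel₀ (abs_ne_zero.2 hxk) h7)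
  have hall : ∀ k, |a k| = |a m| := by
    intro k
    by_contra hk
    have h1 := finrank_vectorSpan_add_one_le (A := {k}ᶜ) hne (fun x hx => (key x hx).1)
      (fun x hx j hj => (key x hx).2 j (by simp at hj; rwa [hj]))
    rw [hdim, Finset.card_compl, Finset.card_singleton, Fintype.card_fin] at h1
    omega
  refine ⟨ε, Set.Subset.antisymm (fun x hx => (key x hx).1) fun x hx => ?_⟩
  rw [hl]
  refine ⟨facetSet_subset ε hx, fun y hy => ?_⟩
  rw [hlx, hlx]
  simp only [hall, ← Finset.sum_mul, hx.2]
  refine mul_le_mul_of_nonneg_right ?_ hpos.le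
  exact (Finset.sum_le_sum fun k _ => hsgn y k).trans (sum_abs_le_one hy)

/-- The sign vector of a facet. -/
noncomputable def sign (F : Facet (n := 3) (orthoplex 4)) : Fin 4 → Bool :=
  (exists_eq_facetSet F.2).choose

theorem pts_eq (F : Facet (n := 3) (orthoplex 4)) : F.pts = facetSet (sign F) :=
  (exists_eq_facetSet F.2).choose_spec

theorem sign_injective : Function.Injective sign := by
  intro F G h
  apply Subtype.ext
  change F.pts = G.pts
  rw [pts_eq, pts_eq, h]

theorem eq_zero_of_sgn_ne {ε δ : Fin 4 → Bool} {x : EuclideanSpace ℝ (Fin 4)}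
    (h : x ∈ facetSet ε) (h' : x ∈ facetSet δ) {k : Fin 4} (hk : δ k ≠ ε k) : x k = 0 := by
  have h1 := h.1 k
  have h2 := h'.1 k
  rw [Bool.eq_not_of_ne hk, sgn_not] at h2
  have h3 : sgn (ε k) * x k = 0 := by linarith
  rw [← sgn_mul_sgn_mul (ε k) (x k), h3, mul_zero]

/-- Where signs differ, coordinates vanish on the intersection; two differing signs would leave
dimension at most 1, too small for a ridge. -/
theorem exists_sign_eq_toggle {F G : Facet (n := 3) (orthoplex 4)}
    (h : (dualGraph (n := 3) (orthoplex 4)).Adj F G) : ∃ a, sign G = toggle a (sign F) := by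
  obtain ⟨hne, m, hm, -, hnon, hdim⟩ := h
  have hne' : sign G ≠ sign F := fun e => hne (sign_injective e.symm)
  obtain ⟨a, ha⟩ := Function.ne_iff.1 hne'
  refine ⟨a, ?_⟩
  funext k
  by_cases hk : k = a
  · subst hk
    simpa [toggle] using Bool.eq_not_of_ne ha
  rw [toggle, Function.update_of_ne hk]
  by_contra hk'
  have h1 := finrank_vectorSpan_add_one_le (ε := sign F) (A := {a, k}ᶜ) hnon
    (fun x hx => pts_eq F ▸ hx.1) (fun x hx j hj => by
      have hF : x ∈ facetSet (sign F) := pts_eq F ▸ hx.1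
      have hG : x ∈ facetSet (sign G) := pts_eq G ▸ hx.2
      simp only [Finset.mem_compl, not_not, Finset.mem_insert, Finset.mem_singleton] at hj
      obtain rfl | rfl := hj
      · exact eq_zero_of_sgn_ne hF hG ha
      · exact eq_zero_of_sgn_ne hF hG hk')
  rw [hdim, Finset.card_compl, Finset.card_pair (Ne.symm hk), Fintype.card_fin] at h1
  omega

theorem sgn_mul_sum_smul_vertex (ε : Fin 4 → Bool) (u : Fin 4 → ℝ) (j : Fin 4) :
    sgn (ε j) * (∑ k, u k • vertex ε k) j = u j := by
  simp [vertex_apply, mul_left_comm _ (u j), sgn_mul_self]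

theorem isRegular_vertex (ε : Fin 4 → Bool) : IsRegular (vertex ε) := by
  intro t _
  rw [EuclideanSpace.norm_sq_eq]
  refine Finset.sum_congr rfl fun j _ => ?_
  rw [Real.norm_eq_abs, ← abs_sgn_mul (ε j), sgn_mul_sum_smul_vertex, sq_abs]

theorem IsRegular.dist_sq_eq_two {E : Type*} [NormedAddCommGroup E] [NormedSpace ℝ E]
    {p : Fin 4 → E} (hp : IsRegular p) {j k : Fin 4} (h : j ≠ k) :
    dist (p j) (p k) ^ 2 = 2 := by
  have hsingle : ∀ i : Fin 4, ∑ k, (Pi.single i 1 : Fin 4 → ℝ) k • p k = p i := by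
    intro i
    simp [Pi.single_apply]
  have h1 := hp.dist_sq (t := Pi.single j 1) (s := Pi.single k 1) (by simp)
  rw [hsingle, hsingle] at h1
  rw [h1, Fin.sum_univ_four]
  fin_cases j <;> fin_cases k <;> simp at h ⊢ <;> norm_num

theorem toggle_self (a : Fin 4) (ε : Fin 4 → Bool) : toggle a ε a = !ε a := by
  simp [toggle]

theorem toggle_of_ne {a k : Fin 4} (h : k ≠ a) (ε : Fin 4 → Bool) : toggle a ε k = ε k := by
  simp [toggle, h]

theorem toggle_toggle (a : Fin 4) (ε : Fin 4 → Bool) : toggle a (toggle a ε) = ε := by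
  funext k
  by_cases h : k = a
  · simp [h, toggle_self]
  · simp [toggle_of_ne h]

theorem vertex_toggle {a k : Fin 4} (h : k ≠ a) (ε : Fin 4 → Bool) :
    vertex (toggle a ε) k = vertex ε k := by
  rw [vertex, toggle_of_ne h, vertex]

theorem vertex_notMem_toggle (a : Fin 4) (ε : Fin 4 → Bool) :
    vertex ε a ∉ facetSet (toggle a ε) := by
  intro h
  have h1 := h.1 a
  rw [toggle_self, sgn_not, vertex_apply, if_pos rfl, neg_mul, sgn_mul_self] at h1
  linarith

theorem sgn_toggle_mul {a : Fin 4} {ε : Fin 4 → Bool} {x : EuclideanSpace ℝ (Fin 4)}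
    (h : x a = 0) (k : Fin 4) : sgn (toggle a ε k) * x k = sgn (ε k) * x k := by
  by_cases hk : k = a
  · rw [hk, h, mul_zero, mul_zero]
  · rw [toggle_of_ne hk]

theorem mem_facetSet_toggle {a : Fin 4} {ε : Fin 4 → Bool} {x : EuclideanSpace ℝ (Fin 4)}
    (h : x a = 0) : x ∈ facetSet (toggle a ε) ↔ x ∈ facetSet ε := by
  simp only [facetSet, Set.mem_ofPred_eq, sgn_toggle_mul h]

/-! ### Tree paths and the net property -/

/-- The letter flipped between two facets with adjacent sign vectors. -/
noncomputable def letter (F G : Facet (n := 3) (orthoplex 4)) : Fin 4 :=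
  Classical.epsilon fun a => sign G = toggle a (sign F)

theorem sign_eq_toggle_letter {F G : Facet (n := 3) (orthoplex 4)}
    (h : (dualGraph (n := 3) (orthoplex 4)).Adj F G) :
    sign G = toggle (letter F G) (sign F) :=
  Classical.epsilon_spec (exists_sign_eq_toggle h)

/-- The flips made along a walk. -/
noncomputable def word {T : SimpleGraph (Facet (n := 3) (orthoplex 4))}
    {F G : Facet (n := 3) (orthoplex 4)} (w : T.Walk F G) : List (Fin 4) :=
  w.darts.map fun d => letter d.fst d.snd

theorem trace_word {T : SimpleGraph (Facet (n := 3) (orthoplex 4))}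
    (hT : T ≤ dualGraph (n := 3) (orthoplex 4)) {F G : Facet (n := 3) (orthoplex 4)}
    (w : T.Walk F G) : sign F :: trace (sign F) (word w) = w.support.map sign := by
  induction w with
  | nil => rfl
  | @cons u v _ h w ih =>
    rw [SimpleGraph.Walk.support_cons, List.map_cons, ← ih]
    change _ :: toggle (letter u v) (sign u) :: trace (toggle (letter u v) (sign u)) (word w) = _
    rw [← sign_eq_toggle_letter (hT h)]

theorem word_ne_nil {T : SimpleGraph (Facet (n := 3) (orthoplex 4))}
    {F G : Facet (n := 3) (orthoplex 4)} (h : F ≠ G) (w : T.Walk F G) : word w ≠ [] := by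
  cases w with
  | nil => exact absurd rfl h
  | cons h w => simp [word]

section Unfolding

variable (U : RidgeUnfolding (n := 3) (orthoplex 4))

/-- The vertices of a facet in an unfolding. -/
noncomputable def points (F : Facet (n := 3) (orthoplex 4)) (k : Fin 4) :
    EuclideanSpace ℝ (Fin 3) :=
  U.place F (vertex (sign F) k)

theorem vertex_mem_pts (F : Facet (n := 3) (orthoplex 4)) (k : Fin 4) :
    vertex (sign F) k ∈ F.pts :=
  pts_eq F ▸ vertex_mem (sign F) k

theorem image_eq_convexHull (F : Facet (n := 3) (orthoplex 4)) :
    U.image F = convexHull ℝ (Set.range (points U F)) := by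
  rw [RidgeUnfolding.image, pts_eq, facetSet_eq_convexHull, AffineMap.image_convexHull,
    ← Set.range_comp]
  rfl

theorem isRegular_points (F : Facet (n := 3) (orthoplex 4)) : IsRegular (points U F) := by
  refine isRegular_of_dist fun j k h => ?_
  rw [points, points, U.isometric F _ (vertex_mem_pts F j) _ (vertex_mem_pts F k)]
  exact (isRegular_vertex (sign F)).dist_sq_eq_two h

/-- Attachment fixes the three common vertices, and flatness rules out that the fourth ones
coincide. -/
theorem points_eq_refl {F G : Facet (n := 3) (orthoplex 4)} (h : U.tree.Adj F G) :
    points U G = refl (letter F G) (points U F) := by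
  have hs := sign_eq_toggle_letter (U.isSpanningTree.1 h)
  have hs' : sign F = toggle (letter F G) (sign G) := by rw [hs, toggle_toggle]
  refine (isRegular_points U F).eq_refl (isRegular_points U G) (fun k hk => ?_) fun he => ?_
  · have hv : vertex (sign G) k = vertex (sign F) k := by rw [hs, vertex_toggle hk]
    rw [points, points, hv]
    exact (U.attached F G h _ ⟨vertex_mem_pts F k, hv ▸ vertex_mem_pts G k⟩).symm
  · have hF : vertex (sign F) (letter F G) ∈ F.pts \ G.pts :=
      ⟨vertex_mem_pts F _, by rw [pts_eq, hs]; exact vertex_notMem_toggle _ _⟩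
    have hG : vertex (sign G) (letter F G) ∈ G.pts \ F.pts :=
      ⟨vertex_mem_pts G _, by
        rw [pts_eq, hs']
        exact vertex_notMem_toggle _ _⟩
    have := U.flat F G h _ hF _ hG
    rw [points, points] at he
    rw [he] at this
    exact AffineSubspace.not_sOppSide_self _ _ this

theorem points_eq_develop {F G : Facet (n := 3) (orthoplex 4)} (w : U.tree.Walk F G) :
    points U G = develop (word w) (points U F) := by
  induction w with
  | nil => rfl
  | @cons u v _ h w ih =>
    rw [ih, points_eq_refl U h]
    rfl

theorem isAllNet_orthoplex : IsAllNet (n := 3) (orthoplex 4) := by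
  intro U F G h
  obtain ⟨w, hw, -⟩ := U.isSpanningTree.2.existsUnique_path F G
  have hnd : (sign F :: trace (sign F) (word w)).Nodup := by
    rw [trace_word U.isSpanningTree.1]
    exact hw.support_nodup.map sign_injective
  rw [image_eq_convexHull, image_eq_convexHull, points_eq_develop U w]
  exact (isRegular_points U F).disjoint_interior (separated_of_nodup (word_ne_nil h w) hnd)

end Unfolding

/-! ### Existence of an unfolding for every spanning tree -/

/-- The linear map with `vertex ε k ↦ p k`. -/
noncomputable def placement (ε : Fin 4 → Bool) (p : Fin 4 → EuclideanSpace ℝ (Fin 3)) :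
    EuclideanSpace ℝ (Fin 4) →ₗ[ℝ] EuclideanSpace ℝ (Fin 3) where
  toFun x := ∑ k, (sgn (ε k) * x k) • p k
  map_add' x y := by simp [mul_add, add_smul, Finset.sum_add_distrib]
  map_smul' c x := by simp [Finset.smul_sum, smul_smul, mul_left_comm]

theorem placement_apply (ε : Fin 4 → Bool) (p : Fin 4 → EuclideanSpace ℝ (Fin 3))
    (x : EuclideanSpace ℝ (Fin 4)) : placement ε p x = ∑ k, (sgn (ε k) * x k) • p k :=
  rfl

section placement

variable {ε : Fin 4 → Bool} {p : Fin 4 → EuclideanSpace ℝ (Fin 3)}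
  {x y : EuclideanSpace ℝ (Fin 4)} {a : Fin 4}

theorem dist_placement (hp : IsRegular p) (hx : x ∈ facetSet ε) (hy : y ∈ facetSet ε) :
    dist (placement ε p x) (placement ε p y) = dist x y := by
  rw [← sq_eq_sq₀ dist_nonneg dist_nonneg, placement_apply, placement_apply,
    hp.dist_sq (hx.2.trans hy.2.symm), EuclideanSpace.dist_eq, Real.sq_sqrt (by positivity)]
  refine Finset.sum_congr rfl fun k _ => ?_
  rw [Real.dist_eq, ← abs_sgn_mul (ε k), sq_abs, mul_sub]

theorem placement_toggle (h : x a = 0) :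
    placement (toggle a ε) (refl a p) x = placement ε p x := by
  rw [placement_apply, placement_apply]
  refine Finset.sum_congr rfl fun k _ => ?_
  by_cases hk : k = a
  · rw [hk, h, mul_zero, mul_zero, zero_smul, zero_smul]
  · rw [toggle_of_ne hk, refl_of_ne hk]

theorem IsRegular.coord_sum_smul (hp : IsRegular p) (a : Fin 4) {u : Fin 4 → ℝ}
    (hu : ∑ k, u k = 1) : hp.basis.coord a (∑ k, u k • p k) = u a := by
  rw [← Finset.univ.affineCombination_eq_linear_combination p u hu]
  exact hp.basis.coord_apply_combination_of_mem (Finset.mem_univ a) hu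

theorem sum_smul_mem_span {u : Fin 4 → ℝ} (h0 : ∀ k, 0 ≤ u k) (h1 : ∑ k, u k = 1)
    (ha : u a = 0) :
    ∑ k, u k • p k ∈ affineSpan ℝ (placement ε p '' (facetSet ε ∩ facetSet (toggle a ε))) := by
  apply subset_affineSpan
  have hu := sgn_mul_sum_smul_vertex ε u
  have hmem : ∑ k, u k • vertex ε k ∈ facetSet ε :=
    ⟨fun k => by rw [hu]; exact h0 k, by simp only [hu]; exact h1⟩
  have hz : (∑ k, u k • vertex ε k) a = 0 := by
    rw [← sgn_mul_sgn_mul (ε a) ((∑ k, u k • vertex ε k) a), hu, ha, mul_zero]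
  exact ⟨_, ⟨hmem, (mem_facetSet_toggle hz).2 hmem⟩, by simp only [placement_apply, hu]⟩

theorem pos_of_mem_diff (hx : x ∈ facetSet ε) (hx' : x ∉ facetSet (toggle a ε)) :
    0 < sgn (ε a) * x a := by
  refine lt_of_le_of_ne (hx.1 a) fun h => hx' ?_
  have hz : x a = 0 := by rw [← sgn_mul_sgn_mul (ε a) (x a), ← h, mul_zero]
  exact (mem_facetSet_toggle hz).2 hx

theorem sum_redistribute (a : Fin 4) (t : Fin 4 → ℝ) :
    ∑ k, (if k = a then 0 else t k + t a / 3) = ∑ k, t k := by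
  simp only [Fin.sum_univ_four]
  fin_cases a <;> simp <;> ring

/-- Spreading the weight at `a` evenly over the other vertices projects onto the common face. The
displacements there are positive multiples of `p a` minus the face's centroid, in opposite
directions for the two points. Neither point lies in the plane, as its `a`-th coordinate is nonzero.
-/
theorem sOppSide_sum_smul (hp : IsRegular p) {t s : Fin 4 → ℝ} (ht : ∀ k, 0 ≤ t k)
    (hs : ∀ k, 0 ≤ s k) (ht1 : ∑ k, t k = 1) (hs1 : ∑ k, s k = 1) (hta : 0 < t a)
    (hsa : 0 < s a) :
    (affineSpan ℝ (placement ε p '' (facetSet ε ∩ facetSet (toggle a ε)))).SOppSide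
      (∑ k, t k • p k) (∑ k, s k • refl a p k) := by
  have hmem : ∀ u : Fin 4 → ℝ, (∀ k, 0 ≤ u k) → ∑ k, u k = 1 →
      ∑ k, (if k = a then 0 else u k + u a / 3) • p k ∈
        affineSpan ℝ (placement ε p '' (facetSet ε ∩ facetSet (toggle a ε))) := by
    intro u hu hu1
    refine sum_smul_mem_span (fun k => ?_) ((sum_redistribute a u).trans hu1) (if_pos rfl)
    have := hu k
    have := hu a
    split_ifs <;> positivity
  have hcoord : ∀ z ∈ affineSpan ℝ (placement ε p '' (facetSet ε ∩ facetSet (toggle a ε))),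
      hp.basis.coord a z = 0 := by
    intro z hz
    refine AffineMap.eqOn_affineSpan (f := hp.basis.coord a)
      (g := AffineMap.const ℝ _ (0 : ℝ)) ?_ hz
    rintro _ ⟨x, hx, rfl⟩
    rw [placement_apply, hp.coord_sum_smul a hx.1.2,
      eq_zero_of_sgn_ne hx.1 hx.2 (k := a) (by simp [toggle_self])]
    simp
  rw [sum_smul_refl]
  refine ⟨⟨_, hmem t ht ht1, _, hmem s hs hs1, ?_⟩, fun h => ?_, fun h => ?_⟩
  · have h1 : ∑ k, t k • p k - ∑ k, (if k = a then 0 else t k + t a / 3) • p k =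
        t a • ∑ k, (if k = a then 1 else -(1 / 3 : ℝ)) • p k := by
      rw [← Finset.sum_sub_distrib, Finset.smul_sum]
      refine Finset.sum_congr rfl fun k _ => ?_
      rw [← sub_smul, smul_smul]
      congr 1
      split_ifs with hk
      · rw [hk]; ring
      · ring
    have h2 : ∑ k, (if k = a then 0 else s k + s a / 3) • p k -
        ∑ k, (s k + 2 / 3 * s a - if k = a then 8 / 3 * s a else 0) • p k =
        s a • ∑ k, (if k = a then 1 else -(1 / 3 : ℝ)) • p k := by
      rw [← Finset.sum_sub_distrib, Finset.smul_sum]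
      refine Finset.sum_congr rfl fun k _ => ?_
      rw [← sub_smul, smul_smul]
      congr 1
      split_ifs with hk
      · rw [hk]; ring
      · ring
    rw [vsub_eq_sub, vsub_eq_sub, h1, h2]
    exact (SameRay.rfl.pos_smul_left hta).pos_smul_right hsa
  · have h1 := hcoord _ h
    rw [hp.coord_sum_smul a ht1] at h1
    exact hta.ne' h1
  · have h1 := hcoord _ h
    rw [hp.coord_sum_smul a, if_pos rfl] at h1
    · linarith
    · simp only [Finset.sum_sub_distrib, Finset.sum_add_distrib, hs1, Finset.sum_ite_eq',
        Finset.mem_univ, if_true, Finset.sum_const, Finset.card_univ, Fintype.card_fin,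
        nsmul_eq_mul]
      push_cast
      ring

theorem sOppSide_placement (hp : IsRegular p) (hx : x ∈ facetSet ε)
    (hx' : x ∉ facetSet (toggle a ε)) (hy : y ∈ facetSet (toggle a ε)) (hy' : y ∉ facetSet ε) :
    (affineSpan ℝ (placement ε p '' (facetSet ε ∩ facetSet (toggle a ε)))).SOppSide
      (placement ε p x) (placement (toggle a ε) (refl a p) y) :=
  sOppSide_sum_smul hp hx.1 hy.1 hx.2 hy.2 (pos_of_mem_diff hx hx')
    (pos_of_mem_diff hy (by rwa [toggle_toggle]))

end placement

/-- Alternate vertices of a unit cube. -/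
noncomputable def cubeTetrahedron : Fin 4 → EuclideanSpace ℝ (Fin 3) :=
  ![!₂[1 / 2, 1 / 2, 1 / 2], !₂[1 / 2, -1 / 2, -1 / 2], !₂[-1 / 2, 1 / 2, -1 / 2],
    !₂[-1 / 2, -1 / 2, 1 / 2]]

theorem isRegular_cubeTetrahedron : IsRegular cubeTetrahedron := by
  intro t ht
  rw [EuclideanSpace.real_norm_sq_eq]
  simp only [Fin.sum_univ_four] at ht ⊢
  rw [Fin.sum_univ_three]
  simp [cubeTetrahedron]
  -- The two sides differ by a quarter of `(∑ t k) ^ 2`.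
  linear_combination (-(1 / 4) * (t 0 + t 1 + t 2 + t 3)) * ht

theorem exists_ridgeUnfolding {T : SimpleGraph (Facet (n := 3) (orthoplex 4))}
    (hT : IsSpanningTree (n := 3) (orthoplex 4) T) :
    ∃ U : RidgeUnfolding (n := 3) (orthoplex 4), U.tree = T := by
  obtain ⟨R⟩ := hT.2.connected.nonempty
  choose path hpath _ using fun F => hT.2.existsUnique_path R F
  let pos : Facet (n := 3) (orthoplex 4) → Fin 4 → EuclideanSpace ℝ (Fin 3) := fun F =>
    develop (word (path F)) cubeTetrahedron
  have hreg : ∀ F, IsRegular (pos F) := fun F => isRegular_cubeTetrahedron.develop _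
  have hconcat : ∀ F G (h : T.Adj F G), path G = (path F).concat h →
      pos G = refl (letter F G) (pos F) := by
    intro F G h e
    simp only [pos, e, word, SimpleGraph.Walk.darts_concat, List.concat_eq_append, List.map_append,
      develop_append]
    rfl
  -- In a tree, one of the two root paths extends the other by the edge. Both cases give the same
  -- relation, since `refl` and `toggle` are involutions.
  have hadj : ∀ F G, T.Adj F G → ∃ a, sign G = toggle a (sign F) ∧ pos G = refl a (pos F) := by
    intro F G h
    by_cases hF : F ∈ (path G).support
    · exact ⟨letter F G, sign_eq_toggle_letter (hT.1 h),
        hconcat F G h (hT.2.isAcyclic.path_concat (hpath F) (hpath G) h hF)⟩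
    · have hG := hT.2.isAcyclic.mem_support_of_ne_mem_support_of_adj_of_isPath
        (hpath F) (hpath G) h hF
      have e := hconcat G F h.symm
        (hT.2.isAcyclic.path_concat (hpath G) (hpath F) h.symm hG)
      exact ⟨letter G F, by rw [sign_eq_toggle_letter (hT.1 h.symm), toggle_toggle],
        by rw [e, refl_refl]⟩
  refine ⟨⟨T, hT, fun F => (placement (sign F) (pos F)).toAffineMap, ?_, ?_, ?_⟩, rfl⟩
  · intro F x hx y hy
    rw [pts_eq] at hx hy
    exact dist_placement (hreg F) hx hy
  · intro F G h x hx
    obtain ⟨a, hs, hp⟩ := hadj F G h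
    rw [pts_eq, pts_eq, hs] at hx
    have hz : x a = 0 := eq_zero_of_sgn_ne hx.1 hx.2 (by simp [toggle_self])
    change placement (sign F) (pos F) x = placement (sign G) (pos G) x
    rw [hs, hp, placement_toggle hz]
  · intro F G h x hx y hy
    obtain ⟨a, hs, hp⟩ := hadj F G h
    rw [pts_eq, pts_eq, hs] at hx hy ⊢
    rw [hp]
    exact sOppSide_placement (hreg F) hx.1 hx.2 hy.1 hy.2

end RidgeUnfold

theorem mainTheorem2 :
    (∀ T : SimpleGraph (RidgeUnfold.Facet (n := 3) (RidgeUnfold.orthoplex 4)),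
      RidgeUnfold.IsSpanningTree (n := 3) (RidgeUnfold.orthoplex 4) T →
        ∃ U : RidgeUnfold.RidgeUnfolding (n := 3) (RidgeUnfold.orthoplex 4), U.tree = T) ∧
    RidgeUnfold.IsAllNet (n := 3) (RidgeUnfold.orthoplex 4) :=
  ⟨fun _ hT => RidgeUnfold.exists_ridgeUnfolding hT, RidgeUnfold.isAllNet_orthoplex⟩
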